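/- **Setting.** Let $G$ be a locally compact Hausdorff abelian group with dual $\hat G$ (the continuous homomorphisms $\chi:G\to\mathbb T$, where $\mathbb T=\{z\in\mathbb C:|z|=1\}$). A *group compactification* $(\iota_X,X)$ of $G$ is a compact Hausdorff abelian group $X$ with a continuous homomorphism $\iota_X:G\to X$ with dense image; $\mu_X$ is its normalized Haar measure. Write $(\iota_{X_1},X_1)\le(\iota_{X_2},X_2)$ if there is a continuous homomorphism $\pi:X_2\to X_1$ with $\pi\circ\iota_{X_2}=\iota_{X_1}$. Let $\mathfrak U_{(\iota_X,X)}$ be the filter on $G$ generated by the sets $\iota_X^{-1}(U)$, $U$ a neighbourhood of $0_X$. A set $\Gamma\subseteq\hat G$ induces the compactification $\iota_\Gamma(g)=(\chi(g))_{\chi\in\Gamma}$, $C_\Gamma=\overline{\iota_\Gamma(G)}\le\mathbb T^\Gamma$; the Bohr compactification is $(\iota_b,bG)=(\iota_{\hat G},C_{\hat G})$. $(\iota_X,X)$ is *finite dimensional* if $X$ is topologically isomorphic to a closed subgroup of some $\mathbb T^n$. A bounded function $f:X\to\mathbb C$ is *Riemann integrable* if its set of discontinuities is $\mu_X$-null.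 A function $\phi:G\to\mathbb C$ is *realized* on $(\iota_X,X)$ by $f$ if $f$ is Riemann integrable on $X$ and $\phi=f\circ\iota_X$. $\phi$ is *Hartman measurable* ($\phi\in\mathcal H(G)$) if it can be realized on $bG$; it is *almost periodic* ($\phi\in AP(G)$) if $\phi=f\circ\iota_b$ with $f$ continuous on $bG$; it can be *realized finite dimensionally* if it can be realized on some finite dimensional compactification. For $\phi\in\mathcal H(G)$ realized on $bG$ by $\phi_b$ put $m_G(\phi)=\int_{bG}\phi_b\,d\mu_{bG}$ (this does not depend on $\phi_b$). A Riemann integrable $f$ on $X$ is an *almost realization* of $\phi$ if $m_G(|\phi-f\circ\iota_X|)=0$. With $\tau_xf(y)=f(x+y)$, a (possibly almost) realization $f$ is *aperiodic* if $\{x\in X:\int_X|f-\tau_xf|\,d\mu_X=0\}=\{0_X\}$. Let $\mathcal F(\phi)$ be the filter on $G$ generated by the sets $\{g\in G: m_G(|\phi-\tau_g\phi|)<\varepsilon\}$, $\varepsilon>0$, and let $\Gamma(\phi)\le\hat G$ be the subgroup generated by $\{\chi\in\hat G: m_G(\phi\cdot\overline\chi)\ne0\}$. **Theorem 3.** Let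 $\phi\in\mathcal H(G)$ and $\Gamma=\Gamma(\phi)$. 1. $(\iota_\Gamma,C_\Gamma)\le(\iota_X,X)$ for every group compactification $(\iota_X,X)$ on which $\phi$ can be realized. Moreover $\mathcal F(\phi)\subseteq\mathfrak U_{(\iota_\Gamma,C_\Gamma)}$. 2. If $\phi\in AP(G)$, then $\phi$ has an aperiodic realization on $(\iota_\Gamma,C_\Gamma)$. If $\phi$ can be realized finite dimensionally, then $\phi$ has an aperiodic almost realization on $(\iota_\Gamma,C_\Gamma)$. In both cases $\mathcal F(\phi)=\mathfrak U_{(\iota_\Gamma,C_\Gamma)}$. -/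

import Mathlib

open MeasureTheory TopologicalSpace Topology

universe u v w

namespace Hartman

noncomputable section

/-- A group compactification `(ι, X)` of an abelian topological group `G` (all groups are written
multiplicatively): a compact Hausdorff abelian topological group `X` together with a continuous
homomorphism `ι : G → X` with dense image. -/
structure GroupCompactification (G : Type u) [CommGroup G] [TopologicalSpace G] where
  /-- the compact group `X` -/
  carrier : Type v
  [group : CommGroup carrier]
  [topology : TopologicalSpace carrier]
  [topologicalGroup : IsTopologicalGroup carrier]
  [compact : CompactSpace carrier]
  [hausdorff : T2Space carrier]
  /-- the continuous homomorphism `ι : G → X` -/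
  hom : G →ₜ* carrier
  dense : DenseRange hom

attribute [instance] GroupCompactification.group GroupCompactification.topology
  GroupCompactification.topologicalGroup GroupCompactification.compact
  GroupCompactification.hausdorff

section Compact

variable {X : Type v} [CommGroup X] [TopologicalSpace X] [IsTopologicalGroup X] [CompactSpace X]

/-- The normalized Haar measure on (the Borel sets of) a compact group. -/
def haarProb (X : Type v) [CommGroup X] [TopologicalSpace X] [IsTopologicalGroup X]
    [CompactSpace X] : @Measure X (borel X) :=
  letI : MeasurableSpace X := borel X
  haveI : BorelSpace X := ⟨rfl⟩
  Measure.haarMeasure (⊤ : PositiveCompacts X)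

/-- The integral with respect to normalized Haar measure. -/
def haarIntegral {E : Type*} [NormedAddCommGroup E] [NormedSpace ℝ E] (f : X → E) : E :=
  @integral X E _ _ (borel X) (haarProb X) f

/-- A bounded function `f : X → ℂ` is Riemann integrable if its set of points of discontinuity is
a null set for the normalized Haar measure. -/
def RiemannIntegrable (f : X → ℂ) : Prop :=
  (∃ C : ℝ, ∀ x, ‖f x‖ ≤ C) ∧ haarProb X {x | ¬ ContinuousAt f x} = 0

/-- `d_f(x) = ‖f - τ_x f‖₁`. -/
def translationDist (f : X → ℂ) (x : X) : ℝ :=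
  haarIntegral fun y => ‖f y - f (x * y)‖

/-- `f` is aperiodic: `ker d_f = {x | ‖f - τ_x f‖₁ = 0}` is trivial. -/
def IsAperiodic (f : X → ℂ) : Prop :=
  {x : X | translationDist f x = 0} = {1}

end Compact

variable {G : Type u} [CommGroup G] [TopologicalSpace G]

/-- `X₁.CoveredBy X₂`, i.e. `(ι₁, X₁) ≤ (ι₂, X₂)`: there is a continuous homomorphism
`π : X₂ → X₁` with `π ∘ ι₂ = ι₁`. -/
def GroupCompactification.CoveredBy (X₁ : GroupCompactification.{u, v} G)
    (X₂ : GroupCompactification.{u, w} G) : Prop :=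
  ∃ π : X₂.carrier →ₜ* X₁.carrier, ∀ g, π (X₂.hom g) = X₁.hom g

/-- The filter `𝔘_(ι, X)` on `G`, generated by the preimages under `ι` of the neighbourhoods of
the unit of `X`. -/
def GroupCompactification.unitFilter (X : GroupCompactification.{u, v} G) : Filter G :=
  Filter.comap X.hom (𝓝 1)

/-- `(ι, X)` is finite dimensional: `X` is topologically isomorphic to a closed subgroup of some
finite dimensional torus. -/
def GroupCompactification.FiniteDimensional (X : GroupCompactification.{u, v} G) : Prop :=
  ∃ (n : ℕ) (H : Subgroup (Fin n → Circle)),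
    IsClosed (H : Set (Fin n → Circle)) ∧ Nonempty (X.carrier ≃ₜ* H)

/-- The homomorphism `ι_S : G → 𝕋^S`, `g ↦ (χ(g))_{χ ∈ S}`, for a set `S` of characters. -/
def evalHom (S : Set (PontryaginDual G)) : G →ₜ* (S → Circle) where
  toFun g χ := χ.1 g
  map_one' := by ext χ; simp
  map_mul' g h := by ext χ; simp
  continuous_toFun := continuous_pi fun χ => map_continuous χ.1

/-- `C_S`, the closure of `ι_S(G)` in `𝕋^S`. -/
def closureSubgroup (S : Set (PontryaginDual G)) : Subgroup (S → Circle) :=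
  (evalHom S).toMonoidHom.range.topologicalClosure

theorem evalHom_mem (S : Set (PontryaginDual G)) (g : G) : evalHom S g ∈ closureSubgroup S :=
  Subgroup.le_topologicalClosure _ ⟨g, rfl⟩

/-- The group compactification `(ι_S, C_S)` of `G` induced by a set `S` of characters. -/
def inducedCompactification (S : Set (PontryaginDual G)) : GroupCompactification.{u, u} G where
  carrier := closureSubgroup S
  compact := isCompact_iff_compactSpace.mp
    (Subgroup.isClosed_topologicalClosure (evalHom S).toMonoidHom.range).isCompact
  hom :=
    { toFun := fun g => ⟨evalHom S g, evalHom_mem S g⟩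
      map_one' := by ext1; exact map_one (evalHom S)
      map_mul' := fun g h => by ext1; exact map_mul (evalHom S) g h
      continuous_toFun := (map_continuous (evalHom S)).subtype_mk _ }
  dense := by
    intro x
    rw [Topology.IsInducing.subtypeVal.closure_eq_preimage_closure_image]
    have hx : x.1 ∈ closure (Set.range (evalHom S)) := x.2
    refine closure_mono ?_ hx
    rintro _ ⟨g, rfl⟩
    exact ⟨_, ⟨g, rfl⟩, rfl⟩

/-- The Bohr compactification `(ι_b, bG)`, constructed as the compactification induced by the set
of all characters of `G`. -/
def bohr (G : Type u) [CommGroup G] [TopologicalSpace G] : GroupCompactification.{u, u} G :=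
  inducedCompactification Set.univ

/-- `f` realizes `φ` on `(ι, X)`: `f` is Riemann integrable on `X` and `φ = f ∘ ι`. -/
def IsRealization (φ : G → ℂ) (X : GroupCompactification.{u, v} G) (f : X.carrier → ℂ) : Prop :=
  RiemannIntegrable f ∧ ∀ g, φ g = f (X.hom g)

/-- `φ` can be realized on `(ι, X)`. -/
def RealizableOn (φ : G → ℂ) (X : GroupCompactification.{u, v} G) : Prop :=
  ∃ f : X.carrier → ℂ, IsRealization φ X f

/-- `φ` is Hartman measurable, `φ ∈ ℋ(G)`: it extends to a Riemann integrable function on the Bohr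
compactification. -/
def HartmanMeasurable (φ : G → ℂ) : Prop :=
  RealizableOn φ (bohr G)

/-- `φ` is almost periodic, `φ ∈ AP(G)`: it extends to a continuous function on the Bohr
compactification. -/
def AlmostPeriodic (φ : G → ℂ) : Prop :=
  ∃ f : (bohr G).carrier → ℂ, Continuous f ∧ ∀ g, φ g = f ((bohr G).hom g)

/-- `φ` can be realized finite dimensionally. -/
def FiniteDimensionallyRealizable (φ : G → ℂ) : Prop :=
  ∃ X : GroupCompactification.{u, v} G, X.FiniteDimensional ∧ RealizableOn φ X

open Classical in
/-- The invariant mean `m_G` on Hartman measurable functions: `m_G(φ) = ∫_{bG} φ_b dμ_b` for any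
Riemann integrable extension `φ_b` of `φ` to `bG` (the choice is irrelevant, see
`hartmanMean_eq`). -/
def hartmanMean (φ : G → ℂ) : ℂ :=
  if h : HartmanMeasurable φ then haarIntegral h.choose else 0

/-- The mean `m_G` can be computed from every realization on the Bohr compactification. -/
theorem hartmanMean_eq {φ : G → ℂ} {f : (bohr G).carrier → ℂ} (hf : IsRealization φ (bohr G) f) :
    hartmanMean φ = haarIntegral f := by
  have h : HartmanMeasurable φ := ⟨f, hf⟩
  have hc := h.choose_spec
  rw [hartmanMean, dif_pos h]
  generalize h.choose = f' at hc
  let : MeasurableSpace (bohr G).carrier := borel _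
  unfold haarIntegral
  refine integral_congr_ae ?_
  have h1 : ∀ᵐ x ∂(haarProb (bohr G).carrier), ContinuousAt f x := ae_iff.mpr hf.1.2
  have h2 : ∀ᵐ x ∂(haarProb (bohr G).carrier), ContinuousAt f' x := ae_iff.mpr hc.1.2
  filter_upwards [h1, h2] with x hx1 hx2
  have hne : (𝓝[Set.range (bohr G).hom] x).NeBot :=
    mem_closure_iff_nhdsWithin_neBot.mp ((bohr G).dense x)
  refine tendsto_nhds_unique (hx2.mono_left nhdsWithin_le_nhds)
    ((hx1.mono_left (nhdsWithin_le_nhds (s := Set.range (bohr G).hom))).congr' ?_)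
  filter_upwards [self_mem_nhdsWithin] with y hy
  obtain ⟨g, rfl⟩ := hy
  rw [← hf.2 g, ← hc.2 g]

/-- `f` is an almost realization of `φ` on `(ι, X)`: `f` is Riemann integrable on `X` and
`m_G(|φ - f ∘ ι|) = 0`. -/
def IsAlmostRealization (φ : G → ℂ) (X : GroupCompactification.{u, v} G)
    (f : X.carrier → ℂ) : Prop :=
  RiemannIntegrable f ∧ hartmanMean (fun g => (‖φ g - f (X.hom g)‖ : ℂ)) = 0

/-- `d_φ(g) = m_G(|φ - τ_g φ|)`. -/
def hartmanDist (φ : G → ℂ) (g : G) : ℝ :=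
  (hartmanMean fun h => (‖φ h - φ (g * h)‖ : ℂ)).re

/-- The filter `ℱ(φ)` on `G` generated by the sets `{g | d_φ(g) < ε}`, `ε > 0`. -/
def hartmanFilter (φ : G → ℂ) : Filter G :=
  Filter.generate {A | ∃ ε : ℝ, 0 < ε ∧ A = {g | hartmanDist φ g < ε}}

/-- The set of all characters `χ` with nonvanishing Fourier coefficient `m_G(φ · χ̄)`. -/
def spec (φ : G → ℂ) : Set (PontryaginDual G) :=
  {χ | hartmanMean (fun g => φ g * (starRingEnd ℂ) (χ g : ℂ)) ≠ 0}

/-- `Γ(φ)`, the subgroup of the dual group generated by `spec φ`. -/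
def specGroup (φ : G → ℂ) : Subgroup (PontryaginDual G) :=
  Subgroup.closure (spec φ)

/-- The compactification `(ι_Γ, C_Γ)` induced by `Γ = Γ(φ)`. -/
def specCompactification (φ : G → ℂ) : GroupCompactification.{u, u} G :=
  inducedCompactification (specGroup φ : Set (PontryaginDual G))

end

end Hartman

open Hartman

/-!
The argument takes place on the Bohr compactification `bG`, where `φ` is realized by a Riemann
integrable function `f`. Put `d x = ‖f - τ_x f‖₁`, a continuous function on `bG`, since translation
is continuous in `L¹`; restricted to `G` it is the distance `m_G(|φ - τ_g φ|)`.

The Fourier coefficient of `f - τ_x f` at a character `ξ` is `(1 - ξ x)` times that of `f`. As `bG`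
is a closed subgroup of a torus, its characters are the coordinates, which separate points, and
Stone–Weierstrass shows that a function with vanishing Fourier coefficients vanishes almost
everywhere. Hence `d x = 0` if and only if every `χ ∈ Γ(φ)` is trivial at `x`, that is, the zero set
of `d` is the kernel of `bG → C_Γ` (`IsRealization.translationDist_eq_zero_iff`). By compactness this
gives the equality `ℱ(φ) = 𝔘_(ι_Γ, C_Γ)` for every Hartman measurable `φ`
(`IsRealization.hartmanFilter_eq`).

If `φ` is also realized by `f₁` on `X`, let `Y` be the closure of `G` in `X × bG`. The pullbacks of
`f₁` and `f` to `Y` agree almost everywhere, and the former is invariant under the kernel of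
`Y → X`; a character in the spectrum of `φ`, having a nonzero coefficient, must be trivial on that
kernel. So `Y → bG → C_Γ` factors through `X` (`IsRealization.coveredBy`). No duality theory for `X`
is needed.

Finally, `f` is invariant up to null sets under the kernel of `bG → C_Γ`. Two points of continuity of
`f` in the same fibre then have the same value, and the fact that `bG → C_Γ` is open makes the
resulting function on `C_Γ` continuous at the images of the points of continuity of `f`
(`RiemannIntegrable.exists_descent`). This descended function is an aperiodic almost realization of
`φ` for every Hartman measurable `φ`, and, if `f` is continuous, it is a realization.
-/

namespace Hartman

open Filter

/-! ### Riemann integrable functions on a compact group -/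

/-- Two functions which agree on a dense set agree at every common point of continuity. -/
theorem eq_of_dense_of_continuousAt {X : Type v} [TopologicalSpace X] {f₁ f₂ : X → ℂ}
    {S : Set X} (hS : Dense S) (h : ∀ y ∈ S, f₁ y = f₂ y) {x : X} (h₁ : ContinuousAt f₁ x) (h₂ : ContinuousAt f₂ x) :
    f₁ x = f₂ x := by
  have := mem_closure_iff_nhdsWithin_neBot.1 (hS x)
  refine tendsto_nhds_unique (h₁.mono_left (nhdsWithin_le_nhds (s := S)))
    ((h₂.mono_left nhdsWithin_le_nhds).congr' ?_)
  filter_upwards [self_mem_nhdsWithin] with y hy using (h y hy).symm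

section CompactGroup

variable {X : Type v} [CommGroup X] [TopologicalSpace X] [IsTopologicalGroup X] [CompactSpace X]

/-- Normalized Haar measure on a compact group, for an arbitrary Borel measurable structure.
It unfolds to `haarProb X` when the measurable structure is literally `borel X`. -/
noncomputable abbrev normHaar (X : Type v) [CommGroup X] [TopologicalSpace X]
    [IsTopologicalGroup X] [CompactSpace X] [MeasurableSpace X] [BorelSpace X] : Measure X :=
  Measure.haarMeasure (⊤ : PositiveCompacts X)

variable [MeasurableSpace X] [BorelSpace X]

instance : IsProbabilityMeasure (normHaar X) :=
  ⟨by simpa using Measure.haarMeasure_self (K₀ := (⊤ : PositiveCompacts X))⟩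

theorem haarIntegral_eq {E : Type*} [NormedAddCommGroup E] [NormedSpace ℝ E] (f : X → E) :
    haarIntegral f = ∫ x, f x ∂normHaar X := by
  obtain rfl := BorelSpace.measurable_eq (α := X)
  rfl

theorem riemannIntegrable_iff {f : X → ℂ} :
    RiemannIntegrable f ↔ (∃ C : ℝ, ∀ x, ‖f x‖ ≤ C) ∧ ∀ᵐ x ∂normHaar X, ContinuousAt f x := by
  obtain rfl := BorelSpace.measurable_eq (α := X)
  rfl

theorem translationDist_eq (f : X → ℂ) (x : X) :
    translationDist f x = ∫ y, ‖f y - f (x * y)‖ ∂normHaar X :=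
  haarIntegral_eq _

theorem RiemannIntegrable.ae_continuousAt {f : X → ℂ} (hf : RiemannIntegrable f) :
    ∀ᵐ x ∂normHaar X, ContinuousAt f x :=
  (riemannIntegrable_iff.1 hf).2

/-- Although `X` need not be second countable, an a.e. continuous function is strongly measurable
up to a null set, since it is continuous on the Borel set of its points of continuity. -/
theorem RiemannIntegrable.aestronglyMeasurable {f : X → ℂ} (hf : RiemannIntegrable f) :
    AEStronglyMeasurable f (normHaar X) := by
  have h : ContinuousOn f {x | ContinuousAt f x} := fun x hx => hx.continuousWithinAt
  have := h.aestronglyMeasurable (μ := normHaar X) (measurableSet_of_continuousAt f)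
  have hr : (normHaar X).restrict {x | ContinuousAt f x} = normHaar X :=
    Measure.restrict_eq_self_of_ae_mem hf.ae_continuousAt
  rwa [hr] at this

theorem RiemannIntegrable.integrable {f : X → ℂ} (hf : RiemannIntegrable f) :
    Integrable f (normHaar X) := by
  obtain ⟨C, hC⟩ := hf.1
  exact Integrable.of_bound hf.aestronglyMeasurable C (Eventually.of_forall hC)

theorem measurePreserving_of_surjective {Y : Type w} [CommGroup Y] [TopologicalSpace Y]
    [IsTopologicalGroup Y] [CompactSpace Y] [MeasurableSpace Y] [BorelSpace Y] (p : X →ₜ* Y)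
    (hp : Function.Surjective p) : MeasurePreserving p (normHaar X) (normHaar Y) :=
  MonoidHom.measurePreserving (f := p.toMonoidHom) (map_continuous p) hp (by simp)

end CompactGroup

section CompactGroup

variable {X : Type v} [CommGroup X] [TopologicalSpace X] [IsTopologicalGroup X] [CompactSpace X]

theorem RiemannIntegrable.of_continuous {f : X → ℂ} (hf : Continuous f) : RiemannIntegrable f := by
  borelize X
  refine riemannIntegrable_iff.2 ⟨?_, Eventually.of_forall fun x => hf.continuousAt⟩
  obtain ⟨C, hC⟩ := isCompact_univ.exists_bound_of_continuousOn hf.continuousOn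
  exact ⟨C, fun x => hC x trivial⟩

/-- A continuous function of two Riemann integrable functions is Riemann integrable. -/
theorem RiemannIntegrable.comp₂ {f₁ f₂ : X → ℂ} {F : ℂ → ℂ → ℂ}
    (hF : Continuous (Function.uncurry F)) (h₁ : RiemannIntegrable f₁)
    (h₂ : RiemannIntegrable f₂) : RiemannIntegrable fun x => F (f₁ x) (f₂ x) := by
  borelize X
  refine riemannIntegrable_iff.2 ⟨?_, ?_⟩
  · obtain ⟨C₁, hC₁⟩ := h₁.1
    obtain ⟨C₂, hC₂⟩ := h₂.1
    obtain ⟨C, hC⟩ := ((isCompact_closedBall (0 : ℂ) C₁).prod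
      (isCompact_closedBall (0 : ℂ) C₂)).exists_bound_of_continuousOn hF.continuousOn
    exact ⟨C, fun x => hC (f₁ x, f₂ x) ⟨by simpa using hC₁ x, by simpa using hC₂ x⟩⟩
  · filter_upwards [h₁.ae_continuousAt, h₂.ae_continuousAt] with x hx₁ hx₂
    exact hF.continuousAt.comp (f := fun x => (f₁ x, f₂ x)) (hx₁.prodMk hx₂)

theorem RiemannIntegrable.mul_left {f : X → ℂ} (hf : RiemannIntegrable f) (x : X) :
    RiemannIntegrable fun y => f (x * y) := by
  borelize X
  obtain ⟨C, hC⟩ := hf.1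
  refine riemannIntegrable_iff.2 ⟨⟨C, fun y => hC _⟩, ?_⟩
  filter_upwards [(measurePreserving_mul_left (normHaar X) x).quasiMeasurePreserving.ae
    hf.ae_continuousAt] with y hy
  exact ContinuousAt.comp (f := fun y => x * y) hy (continuous_const_mul x).continuousAt

theorem translationDist_nonneg (f : X → ℂ) (x : X) : 0 ≤ translationDist f x := by
  borelize X
  rw [translationDist_eq]
  exact integral_nonneg fun _ => norm_nonneg _

/-- The translates of an integrable function depend continuously on the translation in `L¹`. -/
theorem RiemannIntegrable.continuous_translationDist {f : X → ℂ} (hf : RiemannIntegrable f) :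
    Continuous (translationDist f) := by
  borelize X
  have hm : MemLp f 1 (normHaar X) := memLp_one_iff_integrable.2 hf.integrable
  have hx (x : X) : MeasurePreserving (fun y => x * y) (normHaar X) (normHaar X) :=
    measurePreserving_mul_left _ x
  let T : X → C(X, X) :=
    (ContinuousMap.curry ⟨fun z : X × X => z.1 * z.2, continuous_mul⟩ : C(X, C(X, X)))
  have hT : Continuous T := map_continuous _
  have key : Continuous fun x : X =>
      Lp.compMeasurePreserving (T x) (hx x) (hm.toLp f) :=
    Continuous.compMeasurePreservingLp (p := 1) continuous_const hT hx ENNReal.one_ne_top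
  have : translationDist f = fun x : X =>
      ‖hm.toLp f - Lp.compMeasurePreserving (T x) (hx x) (hm.toLp f)‖ := by
    funext x
    rw [translationDist_eq, L1.norm_eq_integral_norm]
    refine integral_congr_ae ?_
    filter_upwards [Lp.coeFn_sub (hm.toLp f) (Lp.compMeasurePreserving (T x) (hx x) (hm.toLp f)),
      hm.coeFn_toLp, Lp.coeFn_compMeasurePreserving (hm.toLp f) (hx x),
      (hx x).quasiMeasurePreserving.ae hm.coeFn_toLp] with y h1 h2 h3 h4
    have h3' : Lp.compMeasurePreserving (T x) (hx x) (hm.toLp f) y = f (x * y) := h3.trans h4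
    rw [h1, Pi.sub_apply, h2, h3']
  rw [this]
  exact (continuous_const.sub key).norm

variable {Y : Type w} [CommGroup Y] [TopologicalSpace Y] [IsTopologicalGroup Y] [CompactSpace Y]

theorem RiemannIntegrable.comp_hom {f : Y → ℂ} (hf : RiemannIntegrable f) (p : X →ₜ* Y)
    (hp : Function.Surjective p) : RiemannIntegrable fun x => f (p x) := by
  borelize X Y
  obtain ⟨C, hC⟩ := hf.1
  refine riemannIntegrable_iff.2 ⟨⟨C, fun y => hC _⟩, ?_⟩
  filter_upwards [(measurePreserving_of_surjective p hp).quasiMeasurePreserving.ae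
    hf.ae_continuousAt] with y hy
  exact ContinuousAt.comp (f := p) hy (map_continuous p).continuousAt

theorem RiemannIntegrable.haarIntegral_comp_hom {f : Y → ℂ} (hf : RiemannIntegrable f)
    (p : X →ₜ* Y) (hp : Function.Surjective p) :
    haarIntegral (fun x => f (p x)) = haarIntegral f := by
  borelize X Y
  have h := measurePreserving_of_surjective p hp
  rw [haarIntegral_eq, haarIntegral_eq, ← h.map_eq,
    integral_map h.aemeasurable (h.map_eq ▸ hf.aestronglyMeasurable)]

/-- The integrand `|f - τ_x f|`, as a complex valued function. -/
theorem RiemannIntegrable.norm_sub_translate {f : X → ℂ} (hf : RiemannIntegrable f) (x : X) :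
    RiemannIntegrable fun y => ((‖f y - f (x * y)‖ : ℝ) : ℂ) :=
  hf.comp₂ (F := fun a b => ((‖a - b‖ : ℝ) : ℂ)) (by unfold Function.uncurry; fun_prop)
    (hf.mul_left x)

theorem haarIntegral_ofReal (f : X → ℝ) :
    haarIntegral (fun x => (f x : ℂ)) = ((haarIntegral f : ℝ) : ℂ) := by
  borelize X
  rw [haarIntegral_eq, haarIntegral_eq, integral_complex_ofReal]

theorem RiemannIntegrable.translationDist_comp_hom {f : Y → ℂ} (hf : RiemannIntegrable f)
    (p : X →ₜ* Y) (hp : Function.Surjective p) (x : X) :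
    translationDist (fun x => f (p x)) x = translationDist f (p x) := by
  have h := (hf.norm_sub_translate (p x)).haarIntegral_comp_hom p hp
  rw [haarIntegral_ofReal, haarIntegral_ofReal] at h
  simpa [translationDist] using h

theorem RiemannIntegrable.haarIntegral_congr {f₁ f₂ : X → ℂ} (h₁ : RiemannIntegrable f₁)
    (h₂ : RiemannIntegrable f₂) {S : Set X} (hS : Dense S) (h : ∀ y ∈ S, f₁ y = f₂ y) :
    haarIntegral f₁ = haarIntegral f₂ := by
  borelize X
  rw [haarIntegral_eq, haarIntegral_eq]
  refine integral_congr_ae ?_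
  filter_upwards [h₁.ae_continuousAt, h₂.ae_continuousAt] with x hx₁ hx₂
  exact eq_of_dense_of_continuousAt hS h hx₁ hx₂

theorem RiemannIntegrable.ae_eq_of_translationDist [MeasurableSpace X] [BorelSpace X] {f : X → ℂ}
    (hf : RiemannIntegrable f) {x : X} (hx : translationDist f x = 0) :
    ∀ᵐ y ∂normHaar X, f (x * y) = f y := by
  have hi : Integrable (fun y => ‖f y - f (x * y)‖) (normHaar X) :=
    (hf.integrable.sub (hf.mul_left x).integrable).norm
  rw [translationDist_eq, integral_eq_zero_iff_of_nonneg (fun _ => norm_nonneg _) hi] at hx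
  filter_upwards [hx] with y hy
  exact (sub_eq_zero.1 (norm_eq_zero.1 hy)).symm

/-! ### Fourier coefficients on a compact group -/

/-- The coefficient of `f` at the character `ξ` of a compact group. -/
noncomputable def fourierCoeff (f : X → ℂ) (ξ : PontryaginDual X) : ℂ :=
  haarIntegral fun x => f x * (starRingEnd ℂ) (ξ x : ℂ)

theorem RiemannIntegrable.mul_conj {f : X → ℂ} (hf : RiemannIntegrable f) (ξ : PontryaginDual X) :
    RiemannIntegrable fun x => f x * (starRingEnd ℂ) (ξ x : ℂ) := by
  have hc : Continuous fun x => (ξ x : ℂ) := continuous_subtype_val.comp (map_continuous ξ)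
  refine hf.comp₂ (F := fun a b => a * (starRingEnd ℂ) b) ?_ (.of_continuous hc)
  unfold Function.uncurry
  fun_prop

theorem fourierCoeff_mul_left (f : X → ℂ)
    (ξ : PontryaginDual X) (x : X) :
    fourierCoeff (fun y => f (x * y)) ξ = ξ x * fourierCoeff f ξ := by
  borelize X
  unfold fourierCoeff
  rw [haarIntegral_eq, haarIntegral_eq, ← integral_const_mul,
    ← integral_mul_left_eq_self (fun y => (ξ x : ℂ) * (f y * (starRingEnd ℂ) (ξ y : ℂ))) x]
  refine integral_congr_ae (Eventually.of_forall fun y => ?_)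
  have h : (ξ x : ℂ) * (starRingEnd ℂ) (ξ x : ℂ) = 1 := by
    rw [Complex.mul_conj, Circle.normSq_coe, Complex.ofReal_one]
  simp only [map_mul, Circle.coe_mul]
  linear_combination (-(f (x * y) * (starRingEnd ℂ) (ξ y : ℂ))) * h

theorem RiemannIntegrable.fourierCoeff_sub_translate {f : X → ℂ} (hf : RiemannIntegrable f)
    (ξ : PontryaginDual X) (x : X) :
    fourierCoeff (fun y => f y - f (x * y)) ξ = (1 - ξ x) * fourierCoeff f ξ := by
  have h := fourierCoeff_mul_left f ξ x
  borelize X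
  unfold fourierCoeff at *
  rw [one_sub_mul, ← h, haarIntegral_eq, haarIntegral_eq, haarIntegral_eq,
    ← integral_sub (hf.mul_conj ξ).integrable ((hf.mul_left x).mul_conj ξ).integrable]
  simp only [sub_mul]

/-- The characters of a compact group as continuous complex functions. -/
noncomputable def charMap (ξ : PontryaginDual X) : C(X, ℂ) :=
  ⟨fun x => (ξ x : ℂ), continuous_subtype_val.comp (map_continuous ξ)⟩

/-- The trigonometric polynomials on a compact group. -/
noncomputable def trigPoly (X : Type v) [CommGroup X] [TopologicalSpace X] [IsTopologicalGroup X]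
    [CompactSpace X] : StarSubalgebra ℂ C(X, ℂ) where
  toSubalgebra := Algebra.adjoin ℂ (Set.range charMap)
  star_mem' := by
    change Algebra.adjoin ℂ (Set.range charMap) ≤ star (Algebra.adjoin ℂ (Set.range charMap))
    refine Algebra.adjoin_le ?_
    rintro - ⟨ξ, rfl⟩
    refine Algebra.subset_adjoin ⟨ξ⁻¹, ?_⟩
    ext x
    exact Circle.coe_inv_eq_conj _

theorem trigPoly_coe :
    Subalgebra.toSubmodule (trigPoly X).toSubalgebra = Submodule.span ℂ (Set.range charMap) := by
  refine Algebra.adjoin_eq_span_of_subset ℂ (Set.Subset.trans ?_ Submodule.subset_span)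
  intro f hf
  refine Submonoid.closure_induction (fun _ => id) ⟨1, ?_⟩ ?_ hf
  · ext x
    simp [charMap]
  · rintro - - - - ⟨ξ, rfl⟩ ⟨η, rfl⟩
    refine ⟨ξ * η, ?_⟩
    ext x
    exact Circle.coe_mul _ _

theorem trigPoly_closure (hX : ∀ x : X, (∀ ξ : PontryaginDual X, ξ x = 1) → x = 1) :
    (trigPoly X).topologicalClosure = ⊤ := by
  refine ContinuousMap.starSubalgebra_topologicalClosure_eq_top_of_separatesPoints _ ?_
  intro x y hxy
  by_contra hcon
  refine hxy (div_eq_one.1 (hX _ fun ξ => ?_))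
  rw [map_div, div_eq_one]
  by_contra hne
  refine hcon ⟨_, ⟨charMap ξ, Algebra.subset_adjoin ⟨ξ, rfl⟩, rfl⟩, fun h => hne (Subtype.ext h)⟩

/-- A function is determined by its Fourier coefficients as soon as the characters separate the
points: by Stone–Weierstrass and density of continuous functions in `L¹`, `f` is orthogonal to
itself. -/
theorem RiemannIntegrable.ae_eq_zero_of_fourierCoeff [T2Space X] [MeasurableSpace X] [BorelSpace X]
    (hX : ∀ x : X, (∀ ξ : PontryaginDual X, ξ x = 1) → x = 1) {f : X → ℂ}
    (hf : RiemannIntegrable f) (h : ∀ ξ, fourierCoeff f ξ = 0) : ∀ᵐ x ∂normHaar X, f x = 0 := by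
  have hi : Integrable f (normHaar X) := hf.integrable
  obtain ⟨C, hC⟩ := hf.1
  have hC0 : 0 ≤ C := (norm_nonneg _).trans (hC 1)
  have hfg {g : X → ℂ} (hg : Integrable g (normHaar X)) :
      Integrable (fun x => f x * g x) (normHaar X) :=
    hg.bdd_mul hf.aestronglyMeasurable (Eventually.of_forall hC)
  have hgi (g : C(X, ℂ)) : Integrable g (normHaar X) :=
    (RiemannIntegrable.of_continuous g.continuous).integrable
  have hbound {g : X → ℂ} (hg : Integrable g (normHaar X)) :
      ‖∫ x, f x * g x ∂normHaar X‖ ≤ C * ∫ x, ‖g x‖ ∂normHaar X := by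
    rw [← integral_const_mul]
    refine norm_integral_le_of_norm_le (hg.norm.const_mul C) (Eventually.of_forall fun x => ?_)
    rw [norm_mul]
    exact mul_le_mul_of_nonneg_right (hC x) (norm_nonneg _)
  -- `f` annihilates all trigonometric polynomials
  have h1 : ∀ g ∈ Submodule.span ℂ (Set.range (charMap (X := X))),
      ∫ x, f x * g x ∂normHaar X = 0 := by
    intro g hg
    induction hg using Submodule.span_induction with
    | mem g hg =>
      obtain ⟨ξ, rfl⟩ := hg
      have := h ξ⁻¹
      rw [fourierCoeff, haarIntegral_eq] at this
      rw [← this]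
      refine integral_congr_ae (Eventually.of_forall fun x => ?_)
      have e : (ξ⁻¹ : PontryaginDual X) x = (ξ x)⁻¹ := rfl
      simp [charMap, e, ← Circle.coe_inv_eq_conj]
    | zero => simp
    | add g₁ g₂ _ _ e₁ e₂ =>
      simp only [ContinuousMap.add_apply, mul_add]
      rw [integral_add (hfg (hgi g₁)) (hfg (hgi g₂)), e₁, e₂, add_zero]
    | smul c g _ e =>
      simp only [ContinuousMap.smul_apply, smul_eq_mul, mul_left_comm _ c]
      rw [integral_const_mul, e, mul_zero]
  -- hence all continuous functions
  have h2 : ∀ g : C(X, ℂ), ∫ x, f x * g x ∂normHaar X = 0 := by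
    intro g
    rw [← norm_le_zero_iff]
    refine le_of_forall_pos_le_add fun ε hε => ?_
    have hg : g ∈ closure ((trigPoly X : StarSubalgebra ℂ C(X, ℂ)) : Set C(X, ℂ)) := by
      rw [← StarSubalgebra.topologicalClosure_coe, trigPoly_closure hX]
      trivial
    obtain ⟨q, hq, hgq⟩ := Metric.mem_closure_iff.1 hg (ε / (C + 1)) (by positivity)
    have hq' : q ∈ Submodule.span ℂ (Set.range (charMap (X := X))) := by
      rw [← trigPoly_coe]; exact hq
    have e : ∫ x, f x * g x ∂normHaar X = ∫ x, f x * (g - q) x ∂normHaar X := by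
      simp only [ContinuousMap.sub_apply, mul_sub]
      rw [integral_sub (hfg (hgi g)) (hfg (hgi q)), h1 q hq', sub_zero]
    have hle : ∫ x, ‖(g - q) x‖ ∂normHaar X ≤ ε / (C + 1) := by
      calc ∫ x, ‖(g - q) x‖ ∂normHaar X ≤ ∫ x, ε / (C + 1) ∂normHaar X := by
            refine integral_mono (hgi _).norm (integrable_const _) fun x => ?_
            exact ((g - q).norm_coe_le_norm x).trans ((dist_eq_norm g q) ▸ hgq.le)
        _ = ε / (C + 1) := by simp
    calc ‖∫ x, f x * g x ∂normHaar X‖ ≤ C * ∫ x, ‖(g - q) x‖ ∂normHaar X := by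
          rw [e]; exact hbound (hgi _)
      _ ≤ (C + 1) * (ε / (C + 1)) := by
          gcongr
          linarith
      _ = 0 + ε := by field_simp; ring
  -- hence its own conjugate
  have h3 : ∫ x, f x * (starRingEnd ℂ) (f x) ∂normHaar X = 0 := by
    rw [← norm_le_zero_iff]
    refine le_of_forall_pos_le_add fun ε hε => ?_
    have hfc : Integrable (fun x => (starRingEnd ℂ) (f x)) (normHaar X) :=
      Complex.conjCLE.toContinuousLinearMap.integrable_comp hi
    obtain ⟨g, hg, hgint⟩ := hfc.exists_boundedContinuous_integral_sub_le
      (ε := ε / (C + 1)) (by positivity)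
    have e : ∫ x, f x * (starRingEnd ℂ) (f x) ∂normHaar X =
        ∫ x, f x * ((starRingEnd ℂ) (f x) - g x) ∂normHaar X := by
      simp only [mul_sub]
      have := h2 g.toContinuousMap
      rw [integral_sub (hfg hfc) (hfg hgint)]
      exact (sub_eq_self.2 this).symm
    calc ‖∫ x, f x * (starRingEnd ℂ) (f x) ∂normHaar X‖
          ≤ C * ∫ x, ‖(starRingEnd ℂ) (f x) - g x‖ ∂normHaar X := by
          rw [e]; exact hbound (hfc.sub hgint)
      _ ≤ (C + 1) * (ε / (C + 1)) := by
          gcongr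
          linarith
      _ = 0 + ε := by field_simp; ring
  have h4 : ∫ x, ‖f x‖ ^ 2 ∂normHaar X = 0 := by
    have e : (fun x => f x * (starRingEnd ℂ) (f x)) = fun x => ((‖f x‖ ^ 2 : ℝ) : ℂ) := by
      funext x
      rw [Complex.mul_conj, Complex.normSq_eq_norm_sq]
    rw [e, integral_complex_ofReal] at h3
    exact_mod_cast h3
  rw [integral_eq_zero_iff_of_nonneg (fun x => sq_nonneg _)] at h4
  · filter_upwards [h4] with x hx
    simpa using hx
  · have := (hfg hi.norm.ofReal).norm
    refine this.congr (Eventually.of_forall fun x => ?_)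
    simp [sq]

end CompactGroup

/-! ### Descending along a surjective homomorphism -/

section Factorization

variable {X Y Z : Type*} [CommGroup X] [TopologicalSpace X] [CompactSpace X] [CommGroup Y]
  [TopologicalSpace Y] [T2Space Y] [CommGroup Z] [TopologicalSpace Z]

theorem isQuotientMap_of_surjective (p : X →ₜ* Y) (hp : Function.Surjective p) :
    IsQuotientMap p :=
  (map_continuous p).isClosedMap.isQuotientMap (map_continuous p) hp

theorem surjective_of_denseRange (p : X →ₜ* Y) (hp : DenseRange p) : Function.Surjective p := by
  rw [← Set.range_eq_univ, ← hp.closure_eq]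
  exact (isCompact_range (map_continuous p)).isClosed.closure_eq.symm

/-- A continuous homomorphism that is trivial on the kernel of a continuous surjection of compact
groups factors continuously through it. -/
theorem exists_factor (p : X →ₜ* Y)
    (hp : Function.Surjective p) (q : X →ₜ* Z) (h : ∀ x, p x = 1 → q x = 1) :
    ∃ r : Y →ₜ* Z, ∀ x, r (p x) = q x := by
  have hk : p.toMonoidHom.ker ≤ q.toMonoidHom.ker := fun x hx => h x hx
  let r : Y →* Z := p.toMonoidHom.liftOfSurjective hp ⟨q.toMonoidHom, hk⟩
  have hr : ∀ x, r (p x) = q x := fun x =>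
    MonoidHom.liftOfRightInverse_comp_apply p.toMonoidHom _ _ ⟨q.toMonoidHom, hk⟩ x
  refine ⟨⟨r, ?_⟩, hr⟩
  refine (isQuotientMap_of_surjective p hp).continuous_iff.2 ?_
  exact (map_continuous q).congr fun x => (hr x).symm

end Factorization

section Descent

variable {X : Type v} [CommGroup X] [TopologicalSpace X] [IsTopologicalGroup X] [CompactSpace X]
variable {Y : Type w} [CommGroup Y] [TopologicalSpace Y] [IsTopologicalGroup Y] [CompactSpace Y]
  [T2Space Y]

theorem translationDist_congr [MeasurableSpace X] [BorelSpace X] {f₁ f₂ : X → ℂ}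
    (h : ∀ᵐ x ∂normHaar X, f₁ x = f₂ x) (x : X) :
    translationDist f₁ x = translationDist f₂ x := by
  rw [translationDist_eq, translationDist_eq]
  refine integral_congr_ae ?_
  filter_upwards [h, (measurePreserving_mul_left (normHaar X) x).quasiMeasurePreserving.ae h]
    with y hy hxy
  rw [hy, hxy]

/-- A Riemann integrable function which is invariant, up to null sets, under each element of the
kernel of a surjection `p : X → Y` descends to a Riemann integrable function on `Y`. The descended
function takes at `y` a cluster value of `f` along the points of continuity of `f` approaching the
fibre of `y`; over a point of continuity of `f` there is only one such value, because the
values of `f` at points of continuity are determined by those on any dense set. -/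
theorem RiemannIntegrable.exists_descent {f : X → ℂ} (hf : RiemannIntegrable f) (p : X →ₜ* Y)
    (hp : Function.Surjective p) (hker : ∀ n, p n = 1 → translationDist f n = 0) :
    ∃ f' : Y → ℂ, RiemannIntegrable f' ∧
      ∀ x, ContinuousAt f x → f' (p x) = f x ∧ ContinuousAt f' (p x) := by
  borelize X Y
  obtain ⟨C, hC⟩ := hf.1
  set D : Set X := {x | ContinuousAt f x} with hD
  have hopen : IsOpenMap p :=
    (MonoidHom.isOpenQuotientMap_of_isQuotientMap (isQuotientMap_of_surjective p hp)).isOpenMap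
  have key : ∀ x₀ ∈ D, ∀ ε > 0, ∃ V : Set Y, IsOpen V ∧ p x₀ ∈ V ∧
      ∀ z ∈ D, p z ∈ V → dist (f z) (f x₀) ≤ ε := by
    intro x₀ hx₀ ε hε
    obtain ⟨U, hU, hUo, hxU⟩ := mem_nhds_iff.1
      (hx₀ (Metric.ball_mem_nhds (f x₀) (half_pos hε)))
    refine ⟨p '' U, hopen _ hUo, ⟨x₀, hxU, rfl⟩, ?_⟩
    rintro z hz ⟨u, huU, huz⟩
    -- `z = n * u` with `n` in the kernel; move back from near `z` to near `u`
    have hn : p (z * u⁻¹) = 1 := by rw [map_mul, map_inv, huz, mul_inv_cancel]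
    have hdense := Measure.dense_of_ae (hf.ae_eq_of_translationDist (hker _ hn))
    have ht : Tendsto (fun y => z * u⁻¹ * y) (𝓝 u) (𝓝 z) := by
      have := (continuous_const_mul (z * u⁻¹)).tendsto u
      rwa [inv_mul_cancel_right] at this
    have hW := (ht (hz (Metric.ball_mem_nhds (f z) (half_pos hε))))
    obtain ⟨y, ⟨hyU, hyW⟩, hy⟩ := mem_closure_iff_nhds.1 (hdense u) _
      (inter_mem (hUo.mem_nhds huU) hW)
    have h1 : dist (f y) (f x₀) < ε / 2 := hU hyU
    have h2 : dist (f (z * u⁻¹ * y)) (f z) < ε / 2 := hyW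
    have h3 : f (z * u⁻¹ * y) = f y := hy
    rw [h3] at h2
    linarith [dist_triangle_left (f z) (f x₀) (f y)]
  have hDd : Dense D := Measure.dense_of_ae hf.ae_continuousAt
  have hcl : ∀ y, ∃ c ∈ Metric.closedBall (0 : ℂ) C,
      ClusterPt c (map f (comap p (𝓝 y) ⊓ 𝓟 D)) := by
    intro y
    obtain ⟨x, rfl⟩ := hp y
    have : (𝓝[D] x).NeBot := mem_closure_iff_nhdsWithin_neBot.1 (hDd x)
    have : (comap p (𝓝 (p x)) ⊓ 𝓟 D).NeBot :=
      this.mono (inf_le_inf_right _ (map_continuous p).continuousAt.le_comap)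
    refine isCompact_closedBall (0 : ℂ) C ?_
    exact le_principal_iff.2 (mem_map.2 (Eventually.of_forall fun x => by simpa using hC x))
  choose f' hf'C hf' using hcl
  have hclosed : ∀ {y : Y} {V : Set Y} {S : Set ℂ}, IsOpen V → y ∈ V → IsClosed S →
      (∀ z ∈ D, p z ∈ V → f z ∈ S) → f' y ∈ S := by
    intro y V S hV hy hS h
    rw [← hS.closure_eq, mem_closure_iff_clusterPt]
    refine (hf' y).mono (le_principal_iff.2 ?_)
    exact mem_map.2 (mem_of_superset (inter_mem_inf (preimage_mem_comap (hV.mem_nhds hy))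
      (mem_principal_self D)) fun z hz => h z hz.2 hz.1)
  have hnear : ∀ x ∈ D, ∀ ε > 0, ∃ V : Set Y, IsOpen V ∧ p x ∈ V ∧
      ∀ y ∈ V, dist (f' y) (f x) ≤ ε := by
    intro x hx ε hε
    obtain ⟨V, hV, hxV, h⟩ := key x hx ε hε
    exact ⟨V, hV, hxV, fun y hy => hclosed hV hy Metric.isClosed_closedBall h⟩
  have hval : ∀ x ∈ D, f' (p x) = f x := by
    intro x hx
    refine eq_of_forall_dist_le fun ε hε => ?_
    obtain ⟨V, -, hxV, h⟩ := hnear x hx ε hε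
    exact h _ hxV
  have hcont : ∀ x ∈ D, ContinuousAt f' (p x) := by
    intro x hx
    refine Metric.continuousAt_iff'.2 fun ε hε => ?_
    obtain ⟨V, hV, hxV, h⟩ := hnear x hx (ε / 2) (half_pos hε)
    filter_upwards [hV.mem_nhds hxV] with y hy
    rw [hval x hx]
    exact (h y hy).trans_lt (half_lt_self hε)
  refine ⟨f', riemannIntegrable_iff.2 ⟨⟨C, fun y => by simpa using hf'C y⟩, ?_⟩,
    fun x hx => ⟨hval x hx, hcont x hx⟩⟩
  have hmp := measurePreserving_of_surjective p hp
  rw [← hmp.map_eq]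
  refine (ae_map_iff hmp.aemeasurable (measurableSet_of_continuousAt f')).2 ?_
  filter_upwards [hf.ae_continuousAt] with x hx using hcont x hx

end Descent

/-! ### Compactifications and the Bohr compactification -/

section Bohr

variable {G : Type u} [CommGroup G] [TopologicalSpace G]

/-- The joint compactification `g ↦ (ι₁ g, ι₂ g)`, in the closure of its range in `X₁ × X₂`. -/
def GroupCompactification.joint (X₁ : GroupCompactification.{u, v} G)
    (X₂ : GroupCompactification.{u, w} G) : GroupCompactification.{u, max v w} G where
  carrier := (X₁.hom.prod X₂.hom).toMonoidHom.range.topologicalClosure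
  compact := isCompact_iff_compactSpace.mp
    (Subgroup.isClosed_topologicalClosure (X₁.hom.prod X₂.hom).toMonoidHom.range).isCompact
  hom :=
    { toFun := fun g => ⟨(X₁.hom g, X₂.hom g), Subgroup.le_topologicalClosure _ ⟨g, rfl⟩⟩
      map_one' := by ext1; exact map_one (X₁.hom.prod X₂.hom)
      map_mul' := fun g h => by ext1; exact map_mul (X₁.hom.prod X₂.hom) g h
      continuous_toFun := (map_continuous (X₁.hom.prod X₂.hom)).subtype_mk _ }
  dense := by
    intro x
    rw [Topology.IsInducing.subtypeVal.closure_eq_preimage_closure_image]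
    have hx : x.1 ∈ closure (Set.range (X₁.hom.prod X₂.hom)) := x.2
    refine closure_mono ?_ hx
    rintro _ ⟨g, rfl⟩
    exact ⟨_, ⟨g, rfl⟩, rfl⟩

theorem GroupCompactification.joint_fst (X₁ : GroupCompactification.{u, v} G)
    (X₂ : GroupCompactification.{u, w} G) : X₁.CoveredBy (X₁.joint X₂) :=
  ⟨⟨(MonoidHom.fst _ _).comp (Subgroup.subtype _), continuous_fst.comp continuous_subtype_val⟩,
    fun _ => rfl⟩

theorem GroupCompactification.joint_snd (X₁ : GroupCompactification.{u, v} G)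
    (X₂ : GroupCompactification.{u, w} G) : X₂.CoveredBy (X₁.joint X₂) :=
  ⟨⟨(MonoidHom.snd _ _).comp (Subgroup.subtype _), continuous_snd.comp continuous_subtype_val⟩,
    fun _ => rfl⟩

theorem GroupCompactification.surjective_of_comp {X₁ : GroupCompactification.{u, v} G}
    {X₂ : GroupCompactification.{u, w} G} {π : X₂.carrier →ₜ* X₁.carrier}
    (h : ∀ g, π (X₂.hom g) = X₁.hom g) : Function.Surjective π := by
  refine surjective_of_denseRange π (X₁.dense.mono ?_)
  rintro _ ⟨g, rfl⟩
  exact ⟨_, h g⟩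

/-- Restriction of coordinates `C_T → C_S` for `S ⊆ T`. -/
def restrictHom {S T : Set (PontryaginDual G)} (h : S ⊆ T) :
    (inducedCompactification T).carrier →ₜ* (inducedCompactification S).carrier where
  toFun x := ⟨fun χ => x.1 ⟨χ, h χ.2⟩, by
    have hc : Continuous fun z : T → Circle => fun χ : S => z ⟨χ, h χ.2⟩ := by fun_prop
    have hx : x.1 ∈ closure (Set.range (evalHom T)) := x.2
    refine map_mem_closure hc hx ?_
    rintro _ ⟨g, rfl⟩
    exact ⟨g, rfl⟩⟩
  map_one' := rfl
  map_mul' _ _ := rfl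
  continuous_toFun := by
    refine Continuous.subtype_mk ?_ _
    exact continuous_pi fun χ => (continuous_apply _).comp continuous_subtype_val

/-- The extension of a character of `G` to its Bohr compactification, a coordinate projection. -/
def bohrChar (χ : PontryaginDual G) : PontryaginDual (bohr G).carrier where
  toFun x := x.1 ⟨χ, trivial⟩
  map_one' := rfl
  map_mul' _ _ := rfl
  continuous_toFun := (continuous_apply _).comp continuous_subtype_val

theorem bohrChar_unique {χ : PontryaginDual G} {ξ : PontryaginDual (bohr G).carrier}
    (h : ∀ g, ξ ((bohr G).hom g) = χ g) : bohrChar χ = ξ := by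
  refine PontryaginDual.ext fun x => congrFun ?_ x
  refine (bohr G).dense.equalizer (map_continuous _) (map_continuous _) (funext fun g => ?_)
  exact (h g).symm

/-- Every character of the Bohr compactification is a coordinate projection. -/
theorem bohrChar_surjective : Function.Surjective (bohrChar (G := G)) := fun ξ =>
  ⟨(ContinuousMonoidHom.comp ξ (bohr G).hom : G →ₜ* Circle), bohrChar_unique fun _ => rfl⟩

theorem bohrChar_mul (χ ψ : PontryaginDual G) : bohrChar (χ * ψ) = bohrChar χ * bohrChar ψ :=
  bohrChar_unique fun _ => rfl

theorem eq_one_of_bohrChar (x : (bohr G).carrier)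
    (h : ∀ ξ : PontryaginDual (bohr G).carrier, ξ x = 1) : x = 1 :=
  Subtype.ext (funext fun χ => h (bohrChar χ.1))

/-! ### The compactification induced by the spectrum -/

variable (φ : G → ℂ)

/-- The canonical map from the Bohr compactification onto `C_Γ`, where `Γ = Γ(φ)`. -/
def specHom : (bohr G).carrier →ₜ* (specCompactification φ).carrier :=
  restrictHom (Set.subset_univ _)

theorem specHom_hom (g : G) : specHom φ ((bohr G).hom g) = (specCompactification φ).hom g :=
  rfl

theorem specHom_surjective : Function.Surjective (specHom φ) :=
  GroupCompactification.surjective_of_comp (specHom_hom φ)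

theorem specHom_eq_one_iff (x : (bohr G).carrier) :
    specHom φ x = 1 ↔ ∀ χ ∈ spec φ, bohrChar χ x = 1 := by
  constructor
  · intro h χ hχ
    exact congrFun (congrArg Subtype.val h) ⟨χ, Subgroup.subset_closure hχ⟩
  · intro h
    let e : PontryaginDual G →* Circle :=
      MonoidHom.mk' (fun χ => bohrChar χ x) fun χ ψ => by rw [bohrChar_mul]; rfl
    have hle : specGroup φ ≤ e.ker := (Subgroup.closure_le _).2 h
    exact Subtype.ext (funext fun χ => hle χ.2)

variable {φ} {f : (bohr G).carrier → ℂ}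

theorem IsRealization.mem_spec (hf : IsRealization φ (bohr G) f) (χ : PontryaginDual G) :
    χ ∈ spec φ ↔ fourierCoeff f (bohrChar χ) ≠ 0 := by
  have h : IsRealization (fun g => φ g * (starRingEnd ℂ) (χ g : ℂ)) (bohr G)
      fun x => f x * (starRingEnd ℂ) (bohrChar χ x : ℂ) :=
    ⟨hf.1.mul_conj _, fun g => congrArg (· * (starRingEnd ℂ) (χ g : ℂ)) (hf.2 g)⟩
  change hartmanMean _ ≠ 0 ↔ _
  rw [hartmanMean_eq h, fourierCoeff]

theorem IsRealization.hartmanDist_eq (hf : IsRealization φ (bohr G) f) (g : G) :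
    hartmanDist φ g = translationDist f ((bohr G).hom g) := by
  have h : IsRealization (fun h => (‖φ h - φ (g * h)‖ : ℂ)) (bohr G)
      fun y => ((‖f y - f ((bohr G).hom g * y)‖ : ℝ) : ℂ) :=
    ⟨hf.1.norm_sub_translate _, fun h => by simp only [hf.2 h, hf.2 (g * h), map_mul]⟩
  rw [hartmanDist, hartmanMean_eq h, haarIntegral_ofReal, Complex.ofReal_re, translationDist]

/-- The kernel of `bG → C_Γ` consists of the periods of `f` modulo null sets: the Fourier
coefficient of `f - τ_x f` at `ξ` is `1 - ξ x` times that of `f`. -/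
theorem IsRealization.translationDist_eq_zero_iff (hf : IsRealization φ (bohr G) f)
    (x : (bohr G).carrier) : translationDist f x = 0 ↔ specHom φ x = 1 := by
  borelize (bohr G).carrier
  have hsub : RiemannIntegrable fun y => f y - f (x * y) :=
    hf.1.comp₂ (F := fun a b => a - b) (by unfold Function.uncurry; fun_prop) (hf.1.mul_left x)
  rw [specHom_eq_one_iff]
  constructor
  · intro h χ hχ
    have h0 : fourierCoeff (fun y => f y - f (x * y)) (bohrChar χ) = 0 := by
      rw [fourierCoeff, haarIntegral_eq]
      refine integral_eq_zero_of_ae ?_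
      filter_upwards [hf.1.ae_eq_of_translationDist h] with y hy
      simp [hy]
    rw [hf.1.fourierCoeff_sub_translate] at h0
    have := (mul_eq_zero.1 h0).resolve_right ((hf.mem_spec χ).1 hχ)
    exact Subtype.ext (sub_eq_zero.1 this).symm
  · intro h
    have h0 : ∀ ξ, fourierCoeff (fun y => f y - f (x * y)) ξ = 0 := by
      intro ξ
      obtain ⟨χ, rfl⟩ := bohrChar_surjective ξ
      rw [hf.1.fourierCoeff_sub_translate]
      by_cases hχ : χ ∈ spec φ
      · rw [h χ hχ, Circle.coe_one, sub_self, zero_mul]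
      · rw [not_not.1 (mt (hf.mem_spec χ).2 hχ), mul_zero]
    rw [translationDist_eq]
    refine integral_eq_zero_of_ae ?_
    filter_upwards [hsub.ae_eq_zero_of_fourierCoeff eq_one_of_bohrChar h0] with y hy
    simp [hy]

/-- The filter of `φ` is the filter of neighbourhoods of the unit in `C_Γ`: the continuous function
`x ↦ ‖f - τ_x f‖₁` on the compact group `bG` vanishes exactly on the kernel of `bG → C_Γ`. -/
theorem IsRealization.hartmanFilter_eq (hf : IsRealization φ (bohr G) f) :
    hartmanFilter φ = (specCompactification φ).unitFilter := by
  have hd := hf.1.continuous_translationDist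
  have hp := map_continuous (specHom φ)
  have hzero := hf.translationDist_eq_zero_iff
  refine le_antisymm ?_ (le_generate_iff.2 ?_)
  · rintro s ⟨U, hU, hUs⟩
    obtain ⟨V, hVU, hV, h1V⟩ := mem_nhds_iff.1 hU
    have hK : IsCompact (specHom φ ⁻¹' V)ᶜ := (hV.preimage hp).isClosed_compl.isCompact
    obtain ⟨ε, hε, h⟩ := hK.exists_forall_le' hd.continuousOn (a := 0) fun x hx => by
      refine lt_of_le_of_ne (translationDist_nonneg f x) fun h0 => hx ?_
      rw [Set.mem_preimage, (hzero x).1 h0.symm]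
      exact h1V
    refine mem_of_superset (mem_generate_of_mem ⟨ε, hε, rfl⟩) fun g hg => hUs (hVU ?_)
    by_contra hgV
    have := h ((bohr G).hom g) hgV
    rw [← hf.hartmanDist_eq] at this
    exact absurd hg (not_lt.2 this)
  · rintro _ ⟨ε, hε, rfl⟩
    have hK : IsClosed (specHom φ '' {x | ε ≤ translationDist f x}) :=
      ((isClosed_le continuous_const hd).isCompact.image hp).isClosed
    refine ⟨_, hK.isOpen_compl.mem_nhds ?_, fun g hg => ?_⟩
    · rintro ⟨x, hx, h1⟩
      have hx' : ε ≤ translationDist f x := hx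
      rw [(hzero x).2 h1] at hx'
      exact absurd hε (not_lt.2 hx')
    · by_contra hlt
      refine hg ⟨(bohr G).hom g, ?_, rfl⟩
      rw [Set.mem_ofPred_eq, ← hf.hartmanDist_eq]
      exact not_lt.1 hlt

/-- On the joint compactification of `X` and `bG`, the two pullbacks of the realizations of `φ`
coincide up to a null set. Being invariant under the kernel of the projection to `X`, this function
is orthogonal to all characters that are nontrivial there, so that `Γ(φ)` is trivial on it. -/
theorem IsRealization.coveredBy (hf : IsRealization φ (bohr G) f)
    (X : GroupCompactification.{u, v} G) {f₁ : X.carrier → ℂ} (hf₁ : IsRealization φ X f₁) :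
    (specCompactification φ).CoveredBy X := by
  obtain ⟨p, hp⟩ := X.joint_fst (bohr G)
  obtain ⟨q, hq⟩ := X.joint_snd (bohr G)
  have hps := GroupCompactification.surjective_of_comp hp
  have hqs := GroupCompactification.surjective_of_comp hq
  obtain ⟨r, hr⟩ := exists_factor p hps ((specHom φ).comp q) fun k hk => by
    refine (specHom_eq_one_iff φ _).2 fun χ hχ => ?_
    let η : PontryaginDual (X.joint (bohr G)).carrier :=
      (ContinuousMonoidHom.comp (bohrChar χ) q : _ →ₜ* Circle)
    have h1 : fourierCoeff (fun y => f (q y)) η = fourierCoeff f (bohrChar χ) :=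
      (hf.1.mul_conj (bohrChar χ)).haarIntegral_comp_hom q hqs
    have h2 : fourierCoeff (fun y => f₁ (p y)) η = fourierCoeff (fun y => f (q y)) η := by
      refine ((hf₁.1.comp_hom p hps).mul_conj η).haarIntegral_congr
        ((hf.1.comp_hom q hqs).mul_conj η) (X.joint (bohr G)).dense ?_
      rintro _ ⟨g, rfl⟩
      refine congrArg (· * _) ?_
      simp only [hp, hq, ← hf.2 g, ← hf₁.2 g]
    have h3 := fourierCoeff_mul_left (fun y => f₁ (p y)) η k
    simp only [map_mul, hk, one_mul] at h3
    have h4 : fourierCoeff (fun y => f₁ (p y)) η ≠ 0 := by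
      rw [h2, h1]
      exact (hf.mem_spec χ).1 hχ
    exact Subtype.ext ((mul_eq_right₀ h4).1 h3.symm)
  refine ⟨r, fun g => ?_⟩
  rw [← hp, hr]
  exact congrArg (specHom φ) (hq g)

/-- Every realization on `bG` descends to an aperiodic almost realization on `C_Γ`; it is preserved
at its points of continuity. -/
theorem IsRealization.exists_aperiodic (hf : IsRealization φ (bohr G) f) :
    ∃ f' : (specCompactification φ).carrier → ℂ,
      IsAlmostRealization φ (specCompactification φ) f' ∧ IsAperiodic f' ∧
      ∀ x, ContinuousAt f x → f' (specHom φ x) = f x := by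
  obtain ⟨f', hf', h⟩ := hf.1.exists_descent (specHom φ) (specHom_surjective φ)
    fun n hn => (hf.translationDist_eq_zero_iff n).2 hn
  borelize (bohr G).carrier
  have hae : ∀ᵐ x ∂normHaar (bohr G).carrier, f' (specHom φ x) = f x := by
    filter_upwards [hf.1.ae_continuousAt] with x hx using (h x hx).1
  refine ⟨f', ⟨hf', ?_⟩, ?_, fun x hx => (h x hx).1⟩
  · have hreal : IsRealization
        (fun g => (‖φ g - f' ((specCompactification φ).hom g)‖ : ℂ)) (bohr G)
        fun x => ((‖f x - f' (specHom φ x)‖ : ℝ) : ℂ) :=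
      ⟨hf.1.comp₂ (F := fun a b => ((‖a - b‖ : ℝ) : ℂ)) (by unfold Function.uncurry; fun_prop)
        (hf'.comp_hom _ (specHom_surjective φ)), fun g => by simp only [hf.2 g, specHom_hom]⟩
    rw [hartmanMean_eq hreal, haarIntegral_eq]
    refine integral_eq_zero_of_ae ?_
    filter_upwards [hae] with x hx
    simp [hx]
  · ext y
    obtain ⟨x, rfl⟩ := specHom_surjective φ y
    rw [Set.mem_ofPred_eq, Set.mem_singleton_iff,
      ← hf'.translationDist_comp_hom _ (specHom_surjective φ), translationDist_congr hae,
      hf.translationDist_eq_zero_iff]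

end Bohr

end Hartman

theorem theorem3 {G : Type u} [CommGroup G] [TopologicalSpace G] [IsTopologicalGroup G]
    [LocallyCompactSpace G] [T2Space G] (φ : G → ℂ) (hφ : HartmanMeasurable φ) :
    ((∀ X : GroupCompactification.{u, v} G, RealizableOn φ X →
        (specCompactification φ).CoveredBy X) ∧
      (hartmanFilter φ).sets ⊆ (specCompactification φ).unitFilter.sets) ∧
    (AlmostPeriodic φ →
      (∃ f : (specCompactification φ).carrier → ℂ,
        IsRealization φ (specCompactification φ) f ∧ IsAperiodic f) ∧
      hartmanFilter φ = (specCompactification φ).unitFilter) ∧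
    (FiniteDimensionallyRealizable.{u, w} φ →
      (∃ f : (specCompactification φ).carrier → ℂ,
        IsAlmostRealization φ (specCompactification φ) f ∧ IsAperiodic f) ∧
      hartmanFilter φ = (specCompactification φ).unitFilter) := by
  obtain ⟨f, hf⟩ := hφ
  refine ⟨⟨fun X ⟨_, hf₁⟩ => hf.coveredBy X hf₁, fun s hs => hf.hartmanFilter_eq ▸ hs⟩,
    fun ⟨f₀, hc, hf₀⟩ => ⟨?_, hf.hartmanFilter_eq⟩, fun _ => ⟨?_, hf.hartmanFilter_eq⟩⟩
  · obtain ⟨f', ⟨hR, -⟩, hap, hval⟩ :=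
      IsRealization.exists_aperiodic (φ := φ) ⟨RiemannIntegrable.of_continuous hc, hf₀⟩
    refine ⟨f', ⟨hR, fun g => ?_⟩, hap⟩
    rw [hf₀ g, ← specHom_hom, hval _ hc.continuousAt]
  · obtain ⟨f', halm, hap, -⟩ := hf.exists_aperiodic
    exact ⟨f', halm, hap⟩
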